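/- Let $k\ge 5$ be an integer. A real $m\times n$ matrix $A$ of full column rank has a QR factorization $A=QR$, where $Q\in\mathbb{R}^{m\times n}$ has orthonormal columns and $R=(r_{ij})\in\mathbb{R}^{n\times n}$ is nonsingular and upper triangular. The matrix $A$ is called KZ (Korkine--Zolotareff) reduced if $|r_{ij}|\le\frac12|r_{ii}|$ for all $1\le i<j\le n$ and $$|r_{ii}|=\min_{x\in\mathbb{Z}^{n-i+1}\setminus\{0\}}\|R_{i:n,\,i:n}\,x\|_2\qquad(1\le i\le n),$$ where $R_{i:n,\,i:n}$ is the submatrix of $R$ with row and column indices from $i$ to $n$. Schnorr's constant is $$\beta_k=\sup_{A}\left|\frac{\prod_{i=1}^{k}r_{ii}}{\prod_{i=k+1}^{2k}r_{ii}}\right|^{2/k},$$ where the supremum is over all KZ reduced real matrices $A$ of full column rank with $2k$ columns (and any number of rows). Then $\beta_k$ is finite and $$\beta_k\le\frac{2^{3\ln 2}}{17^{2\ln 2}}\left(\frac{4k-1}{17}\right)^{\frac{1}{2k-1}}e^{18/k}\,(k-0.5)^{2\ln 2}.$$ -/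

import Mathlib

/-- `A = Q R` is a QR factorization: `Q` has orthonormal columns and `R` is a nonsingular upper
triangular matrix. -/
def IsQRFactorization {m n : ℕ} (A Q : Matrix (Fin m) (Fin n) ℝ)
    (R : Matrix (Fin n) (Fin n) ℝ) : Prop :=
  A = Q * R ∧ Q.transpose * Q = 1 ∧ (∀ i j : Fin n, j < i → R i j = 0) ∧ R.det ≠ 0

/-- The trailing principal submatrix `R_{i:n, i:n}`. -/
def trailingBlock {n : ℕ} (R : Matrix (Fin n) (Fin n) ℝ) (i : Fin n) :
    Matrix {j : Fin n // i ≤ j} {j : Fin n // i ≤ j} ℝ :=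
  R.submatrix Subtype.val Subtype.val

/-- The Korkine–Zolotareff conditions on an upper triangular matrix `R`: it is size-reduced, and
each `|r_ii|` is the minimum of the Euclidean norms `‖R_{i:n, i:n} x‖₂` over nonzero integer
vectors `x`. -/
def IsKZFactor {n : ℕ} (R : Matrix (Fin n) (Fin n) ℝ) : Prop :=
  (∀ i j : Fin n, i < j → |R i j| ≤ 1 / 2 * |R i i|) ∧
  ∀ i : Fin n, IsLeast
    {t : ℝ | ∃ x : {j : Fin n // i ≤ j} → ℤ, x ≠ 0 ∧
      t = ‖WithLp.toLp 2 ((trailingBlock R i).mulVec (fun j => (x j : ℝ)))‖} |R i i|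

/-- The values `|(∏_{i=1}^k r_ii) / (∏_{i=k+1}^{2k} r_ii)|^{2/k}`, where `R = (r_ij)` runs through
the R-factors of all KZ reduced matrices of full column rank with `2k` columns (and any number `m`
of rows). The absolute value makes this independent of the choice of signs of the `r_ii`, which
a QR factorization leaves free. -/
def schnorrValues (k : ℕ) : Set ℝ :=
  {t : ℝ | ∃ (m : ℕ) (A Q : Matrix (Fin m) (Fin (2 * k)) ℝ)
      (R : Matrix (Fin (2 * k)) (Fin (2 * k)) ℝ),
    LinearIndependent ℝ A.col ∧ IsQRFactorization A Q R ∧ IsKZFactor R ∧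
    t = |(∏ i : Fin (2 * k) with i.val < k, R i i) /
          (∏ i : Fin (2 * k) with k ≤ i.val, R i i)| ^ ((2 : ℝ) / (k : ℝ))}

/-- Schnorr's constant `β_k`. -/
noncomputable def schnorrConstant (k : ℕ) : ℝ := sSup (schnorrValues k)

/-! Let `S n` be the sum of the last `n` values `log |r_ii|`. The last `n` rows and columns of `R`
span a lattice of covolume `exp (S n)` whose minimum is the leading diagonal entry, so Blichfeldt's
bound, weakened to γₙ ≤ 2(n+17)/17 for n ≥ 6, bounds that entry (`IsKZFactor.two_mul_log_diag_le`).
Written for the averages `S n / n`, the inequality telescopes (`sum_average_sub_le`). Since the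
logarithm of a Schnorr value is 4(S(2k)/(2k) - S(k)/k), it is at most the sum of 2 log(2(j+18)/17)/j
over k ≤ j < 2k.

That sum behaves like the integral of 2 log(2t/17)/t, a difference of squared logarithms.
`two_mul_log_div_le` is its discrete form; the shift by 18 produces the factor e^(18/k). -/

/-! ### Gamma function estimates behind the linear bound on Hermite's constant. -/

/-- A Stirling-type upper bound for the Gamma function at positive half-integers. -/
theorem log_Gamma_half_add_two_le (n : ℕ) :
    Real.log (Real.Gamma ((n : ℝ) / 2 + 2)) ≤
      ((n : ℝ) / 2 + 3 / 2) * Real.log ((n : ℝ) / 2 + 1) - (n : ℝ) / 2 := by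
  induction n using Nat.strong_induction_on with
  | _ n ih =>
    rcases n with _ | _ | n
    · norm_num
    · have h1 : Real.Gamma (((0 + 1 : ℕ) : ℝ) / 2 + 2) = 3 / 4 * √Real.pi := by
        have e : (((0 + 1 : ℕ) : ℝ) / 2 + 2) = (1 / 2 + 1) + 1 := by norm_num
        rw [e, Real.Gamma_add_one (by norm_num), Real.Gamma_add_one (by norm_num),
          Real.Gamma_one_half_eq]
        ring
      rw [h1, Real.log_mul (by norm_num) (by positivity), Real.log_sqrt Real.pi_pos.le]
      have h2 : (((0 + 1 : ℕ) : ℝ) / 2 + 1) = 3 / 2 := by norm_num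
      have h3 : (((0 + 1 : ℕ) : ℝ) / 2 + 3 / 2) = 2 := by norm_num
      have h4 : (((0 + 1 : ℕ) : ℝ) / 2) = 1 / 2 := by norm_num
      rw [h2, h3, h4]
      have h5 : Real.log (3 / 4 : ℝ) = Real.log 3 - 2 * Real.log 2 := by
        rw [Real.log_div (by norm_num) (by norm_num), show (4 : ℝ) = 2 ^ 2 by norm_num,
          Real.log_pow]
        norm_num
      have h6 : Real.log (3 / 2 : ℝ) = Real.log 3 - Real.log 2 :=
        Real.log_div (by norm_num) (by norm_num)
      have h7 : Real.log Real.pi ≤ Real.log 3 + 3.141593 / 3 - 1 := by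
        have := Real.log_le_sub_one_of_pos (x := Real.pi / 3) (by positivity)
        rw [Real.log_div (by positivity) (by norm_num)] at this
        have := Real.pi_lt_d6
        linarith
      have h8 : 2 * (3 / 2 - 1) / ((3 / 2 - 1 : ℝ) + 2) ≤ Real.log (1 + (3 / 2 - 1 : ℝ)) :=
        Real.le_log_one_add_of_nonneg (by norm_num)
      have h9 : (1 + (3 / 2 - 1 : ℝ)) = 3 / 2 := by norm_num
      rw [h9, h6] at h8
      have := Real.log_two_gt_d9
      rw [h5, h6]
      linarith
    · have ihn := ih n (by omega)
      set s : ℝ := (n : ℝ) / 2 with hs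
      have hs0 : 0 ≤ s := by positivity
      have e : (((n + 1 + 1 : ℕ) : ℝ) / 2) = s + 1 := by push_cast; rw [hs]; ring
      rw [e, show s + 1 + 2 = (s + 2) + 1 by ring, Real.Gamma_add_one (by positivity),
        Real.log_mul (by positivity) (Real.Gamma_pos_of_pos (by positivity)).ne']
      -- The induction step is exactly (s + 3/2) log((s+2)/(s+1)) ≥ 1, which log(1+x) ≥ 2x/(x+2)
      -- yields without loss.
      have h1 := Real.le_log_one_add_of_nonneg (x := 1 / (s + 1)) (by positivity)
      have e2 : 1 + 1 / (s + 1) = (s + 2) / (s + 1) := by field_simp; ring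
      rw [e2, Real.log_div (by positivity) (by positivity)] at h1
      have e3 : 2 * (1 / (s + 1)) / (1 / (s + 1) + 2) = 1 / (s + 3 / 2) := by
        field_simp; ring
      rw [e3, div_le_iff₀ (by positivity)] at h1
      rw [show s + 1 + 1 = s + 2 by ring]
      linarith

/-- The logarithm lies below its tangents. -/
theorem log_le_log_add_div_sub_one {x a : ℝ} (hx : 0 < x) (ha : 0 < a) :
    Real.log x ≤ Real.log a + x / a - 1 := by
  have := Real.log_le_sub_one_of_pos (x := x / a) (by positivity)
  rw [Real.log_div hx.ne' ha.ne'] at this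
  linarith

/-- The constant 17 works because eπ > 17/2, barely: the resulting linear gain 0.00465 s must beat
(3/2) log(s+1), helped by s log((s+17/2)/(s+1)), which tends to 15/2. -/
theorem stirling_le_linear {s : ℝ} (hs : 3 ≤ s) :
    (s + 3 / 2) * Real.log (s + 1) - s ≤ s * Real.log (Real.pi * (2 * s + 17) / 17) := by
  have hc : 0.00465 ≤ 1 + Real.log Real.pi - Real.log (17 / 2) := by
    have h := Real.one_sub_inv_le_log_of_pos (x := Real.exp 1 * Real.pi / (17 / 2)) (by positivity)
    rw [Real.log_div (by positivity) (by norm_num), Real.log_mul (by positivity) (by positivity),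
      Real.log_exp] at h
    have h2 : (8.53972 : ℝ) ≤ Real.exp 1 * Real.pi := by
      have h3 := Real.exp_one_gt_d9
      have h4 := Real.pi_gt_d6
      calc (8.53972 : ℝ) ≤ 2.7182818283 * 3.141592 := by norm_num
        _ ≤ _ := by gcongr
    have h5 : (Real.exp 1 * Real.pi / (17 / 2))⁻¹ ≤ (17 / 2) / 8.53972 := by
      rw [inv_div]
      gcongr
    have : (17 / 2 : ℝ) / 8.53972 ≤ 1 - 0.00465 := by norm_num
    linarith
  have hl := Real.le_log_one_add_of_nonneg (x := 15 / (2 * (s + 1))) (by positivity)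
  have e1 : 1 + 15 / (2 * (s + 1)) = (s + 17 / 2) / (s + 1) := by field_simp; ring
  have e2 : 2 * (15 / (2 * (s + 1))) / (15 / (2 * (s + 1)) + 2) = 30 / (4 * s + 19) := by
    field_simp; ring
  rw [e1, e2, Real.log_div (by positivity) (by positivity)] at hl
  have e3 : Real.pi * (2 * s + 17) / 17 = Real.pi * (s + 17 / 2) / (17 / 2) := by ring
  rw [e3, Real.log_div (by positivity) (by norm_num), Real.log_mul (by positivity) (by positivity)]
  have key : 3 / 2 * Real.log (s + 1) ≤ 0.00465 * s + s * (30 / (4 * s + 19)) := by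
    have hlog2 := Real.log_two_lt_d9
    have e4 : s * (30 / (4 * s + 19)) = 7.5 - 142.5 / (4 * s + 19) := by field_simp; ring
    have tangent (m : ℕ) : Real.log (s + 1) ≤ m * Real.log 2 + (s + 1) / 2 ^ m - 1 := by
      rw [← Real.log_pow]
      exact log_le_log_add_div_sub_one (by positivity) (by positivity)
    -- On each range, `d` is an affine majorant of 142.5/(4s+19), and the logarithm is replaced by
    -- its tangent at a power of 2.
    have bound (d : ℝ) (hd : 142.5 ≤ d * (4 * s + 19))
        (h : 3 / 2 * Real.log (s + 1) ≤ 0.00465 * s + 7.5 - d) :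
        3 / 2 * Real.log (s + 1) ≤ 0.00465 * s + s * (30 / (4 * s + 19)) := by
      rw [e4]
      have : 142.5 / (4 * s + 19) ≤ d := by rwa [div_le_iff₀ (by positivity)]
      linarith
    rcases le_total s 20 with h20 | h20
    · have := tangent 3
      norm_num at this
      exact bound (5.6 - 0.17835 * s) (by nlinarith) (by linarith)
    rcases le_total s 100 with h100 | h100
    · have := tangent 6
      norm_num at this
      exact bound (2.6 - 0.0189 * s) (by nlinarith) (by linarith)
    rcases le_total s 350 with h350 | h350
    · have := tangent 8
      norm_num at this
      exact bound (0.67 - 0.00122 * s) (by nlinarith) (by linarith)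
    · have := tangent 9
      norm_num at this
      exact bound 0.12 (by nlinarith) (by linarith)
  nlinarith [mul_le_mul_of_nonneg_left hl (by linarith : 0 ≤ s),
    mul_le_mul_of_nonneg_left hc (by linarith : 0 ≤ s)]

theorem log_Gamma_half_add_two_le_linear {n : ℕ} (hn : 6 ≤ n) :
    Real.log (Real.Gamma ((n : ℝ) / 2 + 2)) ≤
      (n : ℝ) / 2 * Real.log (Real.pi * (n + 17) / 17) := by
  have hn' : (6 : ℝ) ≤ n := by exact_mod_cast hn
  have h := stirling_le_linear (s := (n : ℝ) / 2) (by linarith)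
  rw [show 2 * ((n : ℝ) / 2) = n by ring] at h
  exact (log_Gamma_half_add_two_le n).trans h

/-! ### Closed form for the weighted sum of logarithms. -/

/-- Sharper than log x ≤ x - 1, which at x = (t+18)/t would cost 36/t², more than the available
36/(t(t+1)). -/
theorem log_le_half_sub_inv {x : ℝ} (hx : 1 ≤ x) : Real.log x ≤ (x - x⁻¹) / 2 := by
  rw [← Real.sinh_log (by linarith)]
  exact Real.self_le_sinh_iff.2 (Real.log_nonneg hx)

/-- The difference of squares is l(2M + l), with l ≈ 1/t and 2M + l ≈ 2 log(2t/17), by symmetry of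
2t ± 1 about 2t. The last term pays for the shift by 18 and the O(t⁻³) errors. -/
theorem two_mul_log_div_le {t : ℝ} (ht : 5 ≤ t) :
    2 * (Real.log (2 * (t + 18) / 17) / t) ≤
      Real.log ((2 * t + 1) / 17) ^ 2 - Real.log ((2 * t - 1) / 17) ^ 2 +
        36 * (1 / t - 1 / (t + 1)) := by
  have ht0 : 0 < t := by linarith
  have ht1 : 0 < 2 * t - 1 := by linarith
  set G := Real.log (2 * t / 17) with hG
  set M := Real.log ((2 * t - 1) / 17) with hM
  set l := Real.log ((2 * t + 1) / (2 * t - 1)) with hl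
  have hN : Real.log ((2 * t + 1) / 17) = M + l := by
    rw [hM, hl, ← Real.log_mul (by positivity) (by positivity)]
    congr 1
    field_simp
  have hl1 : 1 / t ≤ l := by
    have h := Real.le_log_one_add_of_nonneg (x := 2 / (2 * t - 1)) (by positivity)
    have e1 : 1 + 2 / (2 * t - 1) = (2 * t + 1) / (2 * t - 1) := by field_simp; ring
    have e2 : 2 * (2 / (2 * t - 1)) / (2 / (2 * t - 1) + 2) = 1 / t := by
      field_simp; ring
    rwa [e1, e2] at h
  have hl2 : l ≤ 2 / (2 * t - 1) := by
    have h := Real.log_le_sub_one_of_pos (x := (2 * t + 1) / (2 * t - 1)) (by positivity)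
    have e1 : (2 * t + 1) / (2 * t - 1) - 1 = 2 / (2 * t - 1) := by field_simp; ring
    rwa [e1] at h
  have he : 2 * G - 1 / (4 * t ^ 2 - 1) ≤ 2 * M + l := by
    have h4 : 0 < 4 * t ^ 2 - 1 := by nlinarith
    have h := Real.one_sub_inv_le_log_of_pos
      (x := (2 * t + 1) / 17 * ((2 * t - 1) / 17) / (2 * t / 17 * (2 * t / 17))) (by positivity)
    rw [Real.log_div (by positivity) (by positivity), Real.log_mul (by positivity) (by positivity),
      Real.log_mul (by positivity) (by positivity), hN, ← hM, ← hG] at h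
    have e1 : 1 - ((2 * t + 1) / 17 * ((2 * t - 1) / 17) / (2 * t / 17 * (2 * t / 17)))⁻¹ =
        - (1 / (4 * t ^ 2 - 1)) := by
      have : 4 * t ^ 2 - 1 = (2 * t + 1) * (2 * t - 1) := by ring
      rw [this]
      field_simp
      ring
    rw [e1] at h
    linarith
  have hy : Real.log (2 * (t + 18) / 17) ≤ G + 18 * (t + 9) / (t * (t + 18)) := by
    have h := log_le_half_sub_inv (x := (t + 18) / t) (by rw [le_div_iff₀ ht0]; linarith)
    have e1 : ((t + 18) / t - ((t + 18) / t)⁻¹) / 2 = 18 * (t + 9) / (t * (t + 18)) := by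
      field_simp; ring
    rw [e1] at h
    have e2 : Real.log (2 * (t + 18) / 17) = G + Real.log ((t + 18) / t) := by
      rw [hG, ← Real.log_mul (by positivity) (by positivity)]
      congr 1
      field_simp
    linarith
  have hl0 : 0 ≤ l := le_trans (by positivity) hl1
  -- The term 10/t³ is needed only when G < 0, that is t < 17/2, where l ≥ 1/t points the wrong way.
  have hprod : 2 * G * (1 / t) - 10 / t ^ 3 ≤ l * (2 * G) := by
    have h10 : 0 ≤ 10 / t ^ 3 := by positivity
    rcases le_total 0 G with h0 | h0
    · nlinarith [mul_le_mul_of_nonneg_right hl1 h0]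
    · have h8 : t ≤ 17 / 2 := by
        have := (Real.log_nonpos_iff (by positivity)).1 h0
        linarith
      have hG1 : -(7 / 10) ≤ G := by
        have h := Real.one_sub_inv_le_log_of_pos (x := 2 * t / 17) (by positivity)
        rw [inv_div] at h
        have : 17 / (2 * t) ≤ 17 / 10 := by gcongr; linarith
        linarith
      have hd : 2 / (2 * t - 1) - 1 / t ≤ 50 / 7 / t ^ 3 := by
        rw [div_sub_div _ _ ht1.ne' ht0.ne', div_le_div_iff₀ (by positivity) (by positivity)]
        have : t ^ 3 * (t - 5) ≥ 0 := mul_nonneg (by positivity) (by linarith)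
        nlinarith [mul_nonneg (mul_nonneg ht0.le ht0.le) (by linarith : 0 ≤ 17 / 2 - t)]
      have h1 : (l - 1 / t) * (-G) ≤ 50 / 7 / t ^ 3 * (7 / 10) := by
        apply mul_le_mul (by linarith) (by linarith) (by linarith) (by positivity)
      have e : 50 / 7 / t ^ 3 * (7 / 10) = (10 / t ^ 3) / 2 := by ring
      rw [e] at h1
      linarith
  have hsmall : l * (1 / (4 * t ^ 2 - 1)) ≤ 1 / t ^ 3 := by
    have h4 : 0 < 4 * t ^ 2 - 1 := by nlinarith
    calc l * (1 / (4 * t ^ 2 - 1)) ≤ 2 / (2 * t - 1) * (1 / (4 * t ^ 2 - 1)) := by gcongr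
      _ ≤ 2 / t * (1 / (2 * t ^ 2)) := by
        gcongr
        · linarith
        · nlinarith
      _ = 1 / t ^ 3 := by field_simp
  have hrat : 2 * (18 * (t + 9) / (t * (t + 18)) / t) + 10 / t ^ 3
      + 1 / t ^ 3 ≤ 36 * (1 / t - 1 / (t + 1)) := by
    have e : 36 * (1 / t - 1 / (t + 1)) -
        (2 * (18 * (t + 9) / (t * (t + 18)) / t) + 10 / t ^ 3 + 1 / t ^ 3) =
        (36 * t * (8 * t - 9) - 11 * (t + 1) * (t + 18)) / (t ^ 3 * (t + 1) * (t + 18)) := by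
      field_simp
      ring
    have : 0 ≤ (36 * t * (8 * t - 9) - 11 * (t + 1) * (t + 18)) /
        (t ^ 3 * (t + 1) * (t + 18)) := div_nonneg (by nlinarith) (by positivity)
    linarith
  have h1 := mul_le_mul_of_nonneg_left he hl0
  have h2 : 2 * (Real.log (2 * (t + 18) / 17) / t) ≤
      2 * ((G + 18 * (t + 9) / (t * (t + 18))) / t) := by gcongr
  rw [add_div] at h2
  rw [hN]
  have e3 : 2 * G * (1 / t) = 2 * (G / t) := by ring
  nlinarith

theorem sum_two_mul_log_div_le {k : ℕ} (hk : 5 ≤ k) (m : ℕ) :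
    ∑ j ∈ Finset.range m, 2 * (Real.log (2 * (((k + j : ℕ) : ℝ) + 18) / 17) / ((k + j : ℕ) : ℝ)) ≤
      Real.log ((2 * ((k + m : ℕ) : ℝ) - 1) / 17) ^ 2 - Real.log ((2 * (k : ℝ) - 1) / 17) ^ 2 +
        36 * (1 / (k : ℝ) - 1 / ((k + m : ℕ) : ℝ)) := by
  induction m with
  | zero => simp
  | succ m ih =>
    rw [Finset.sum_range_succ]
    have ht : (5 : ℝ) ≤ ((k + m : ℕ) : ℝ) := by exact_mod_cast (by omega : 5 ≤ k + m)
    have h := two_mul_log_div_le ht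
    have e : ((k + (m + 1) : ℕ) : ℝ) = ((k + m : ℕ) : ℝ) + 1 := by push_cast; ring
    rw [e, show 2 * (((k + m : ℕ) : ℝ) + 1) - 1 = 2 * ((k + m : ℕ) : ℝ) + 1 by ring]
    linarith

theorem log_sq_sub_log_sq_le {t : ℝ} (ht : 5 ≤ t) :
    Real.log ((4 * t - 1) / 17) ^ 2 - Real.log ((2 * t - 1) / 17) ^ 2 ≤
      3 * Real.log 2 * Real.log 2 - 2 * Real.log 2 * Real.log 17 +
        1 / (2 * t - 1) * Real.log ((4 * t - 1) / 17) + 2 * Real.log 2 * Real.log (t - 0.5) := by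
  have ht1 : 0 < 2 * t - 1 := by linarith
  have ht2 : 0 < 4 * t - 1 := by linarith
  set M := Real.log ((2 * t - 1) / 17) with hM
  set L := Real.log ((4 * t - 1) / 17) with hL
  set d := Real.log ((4 * t - 1) / (4 * t - 2)) with hd
  have ht3 : 0 < 4 * t - 2 := by linarith
  have hLM : L = Real.log 2 + M + d := by
    rw [hM, hd, ← Real.log_mul (by norm_num) (by positivity),
      ← Real.log_mul (by positivity) (by positivity), hL]
    congr 1
    rw [show 2 * ((2 * t - 1) / 17) = (4 * t - 2) / 17 by ring, div_mul_div_comm,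
      eq_div_iff (by positivity)]
    ring
  -- Needs 4t - 1 ≥ 17, which t ≥ 5 ensures.
  have hL0 : 0 ≤ L := Real.log_nonneg (by rw [le_div_iff₀ (by norm_num)]; linarith)
  have hd1 : d ≤ 1 / (4 * t - 2) := by
    have h := Real.log_le_sub_one_of_pos (x := (4 * t - 1) / (4 * t - 2)) (by positivity)
    have e : (4 * t - 1) / (4 * t - 2) - 1 = 1 / (4 * t - 2) := by
      rw [div_sub_one ht3.ne']
      ring
    rwa [e] at h
  have hMt : Real.log (t - 0.5) = M + Real.log 17 - Real.log 2 := by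
    rw [hM, ← Real.log_mul (by positivity) (by norm_num), ← Real.log_div (by positivity)
      (by norm_num)]
    congr 1
    ring
  have e : 1 / (2 * t - 1) = 2 * (1 / (4 * t - 2)) := by
    rw [show 4 * t - 2 = 2 * (2 * t - 1) by ring, one_div, one_div, mul_inv]
    ring
  rw [hMt, e]
  have h1 := mul_le_mul_of_nonneg_right hd1 hL0
  have h2 : M = L - Real.log 2 - d := by linarith
  rw [h2]
  nlinarith [sq_nonneg d]

/-- The weighted sum of logarithms controlling Schnorr's constant, bounded in closed form. -/
theorem sum_log_div_le_log_bound {k : ℕ} (hk : 5 ≤ k) :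
    ∑ j ∈ Finset.range k, 2 * (Real.log (2 * (((k + j : ℕ) : ℝ) + 18) / 17) / ((k + j : ℕ) : ℝ)) ≤
      Real.log ((2 : ℝ) ^ (3 * Real.log 2) / (17 : ℝ) ^ (2 * Real.log 2) *
        ((4 * (k : ℝ) - 1) / 17) ^ (1 / (2 * (k : ℝ) - 1)) *
        Real.exp (18 / (k : ℝ)) * ((k : ℝ) - 0.5) ^ (2 * Real.log 2)) := by
  have hk' : (5 : ℝ) ≤ k := by exact_mod_cast hk
  have h1 : 0 < (4 * (k : ℝ) - 1) / 17 := by linarith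
  have h2 : 0 < (k : ℝ) - 0.5 := by linarith
  rw [Real.log_mul (by positivity) (by positivity), Real.log_mul (by positivity) (by positivity),
    Real.log_mul (by positivity) (by positivity), Real.log_div (by positivity) (by positivity),
    Real.log_exp, Real.log_rpow (by norm_num), Real.log_rpow (by norm_num), Real.log_rpow h1,
    Real.log_rpow h2]
  have h3 := sum_two_mul_log_div_le hk k
  have h4 := log_sq_sub_log_sq_le hk'
  have e : ((k + k : ℕ) : ℝ) = 2 * k := by push_cast; ring
  have e2 : 36 * (1 / (k : ℝ) - 1 / (2 * k)) = 18 / k := by field_simp; ring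
  rw [e, e2, show 2 * (2 * (k : ℝ)) - 1 = 4 * k - 1 by ring] at h3
  linarith
-- Blichfeldt's bound on the minimum of a lattice.
section Blichfeldt

open MeasureTheory

/-- Blichfeldt's inequality: among finitely many points at mutual distance at least `l`, the
squared distances to any given point sum to at least `(#s - 1) l² / 2`. -/
theorem sum_one_sub_norm_sq_le_one {E ι : Type*} [NormedAddCommGroup E] [InnerProductSpace ℝ E]
    {l : ℝ} (hl : 0 < l) (s : Finset ι) (v : ι → E)
    (h : ∀ i ∈ s, ∀ j ∈ s, i ≠ j → l ≤ ‖v i - v j‖) :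
    ∑ i ∈ s, (1 - 2 * ‖v i‖ ^ 2 / l ^ 2) ≤ 1 := by
  classical
  rcases s.eq_empty_or_nonempty with rfl | hs
  · simp
  have hm : (0 : ℝ) < s.card := by exact_mod_cast hs.card_pos
  have h1 : ∑ i ∈ s, ∑ j ∈ s, ‖v i - v j‖ ^ 2 =
      2 * s.card * ∑ i ∈ s, ‖v i‖ ^ 2 - 2 * ‖∑ i ∈ s, v i‖ ^ 2 := by
    simp_rw [norm_sub_sq_real, Finset.sum_add_distrib, Finset.sum_sub_distrib,
      ← Finset.mul_sum, ← inner_sum, ← sum_inner, real_inner_self_eq_norm_sq, Finset.sum_const,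
      nsmul_eq_mul, ← Finset.mul_sum]
    ring
  have h2 : (s.card * s.card - s.card : ℝ) * l ^ 2 ≤ ∑ i ∈ s, ∑ j ∈ s, ‖v i - v j‖ ^ 2 := by
    have : ∑ i ∈ s, ∑ j ∈ s, (l ^ 2 - if i = j then l ^ 2 else 0) ≤
        ∑ i ∈ s, ∑ j ∈ s, ‖v i - v j‖ ^ 2 := by
      refine Finset.sum_le_sum fun i hi => Finset.sum_le_sum fun j hj => ?_
      split_ifs with hij
      · simp
      · have := h i hi j hj hij
        rw [sub_zero]
        gcongr
    refine le_trans (le_of_eq ?_) this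
    simp only [Finset.sum_sub_distrib, Finset.sum_const, nsmul_eq_mul, Finset.sum_ite_eq]
    rw [Finset.sum_congr rfl fun i hi => if_pos hi]
    simp only [Finset.sum_const, nsmul_eq_mul]
    ring
  have h3 : (s.card - 1 : ℝ) * l ^ 2 ≤ 2 * ∑ i ∈ s, ‖v i‖ ^ 2 := by
    refine le_of_mul_le_mul_left ?_ hm
    nlinarith [sq_nonneg ‖∑ i ∈ s, v i‖]
  rw [Finset.sum_sub_distrib, ← Finset.sum_div, ← Finset.mul_sum, Finset.sum_const, nsmul_eq_mul,
    mul_one, sub_le_iff_le_add]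
  rw [← sub_le_iff_le_add', le_div_iff₀ (by positivity)]
  exact h3

theorem tsum_ofReal_one_sub_norm_sq_le_one {E ι : Type*} [NormedAddCommGroup E]
    [InnerProductSpace ℝ E] {l : ℝ} (hl : 0 < l) (v : ι → E)
    (h : ∀ i j, i ≠ j → l ≤ ‖v i - v j‖) :
    ∑' i, ENNReal.ofReal (1 - 2 * ‖v i‖ ^ 2 / l ^ 2) ≤ 1 := by
  classical
  rw [ENNReal.tsum_eq_iSup_sum]
  refine iSup_le fun s => ?_
  -- Terms truncated to 0 by `ENNReal.ofReal` are dropped; the remaining points are still separated.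
  rw [← Finset.sum_filter_of_ne (p := fun i => 0 ≤ 1 - 2 * ‖v i‖ ^ 2 / l ^ 2)
    fun i _ hi => (ENNReal.ofReal_pos.1 (pos_iff_ne_zero.2 hi)).le,
    ← ENNReal.ofReal_sum_of_nonneg fun i hi => (Finset.mem_filter.1 hi).2]
  rw [← ENNReal.ofReal_one]
  exact ENNReal.ofReal_le_ofReal (sum_one_sub_norm_sq_le_one hl _ v fun i _ j _ => h i j)

theorem integral_one_sub_norm_sq {E : Type*} [NormedAddCommGroup E] [NormedSpace ℝ E]
    [FiniteDimensional ℝ E] [Nontrivial E] [MeasurableSpace E] [BorelSpace E]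
    (μ : Measure E) [μ.IsAddHaarMeasure] {r : ℝ} (hr : 0 < r) :
    ∫ x, max (1 - ‖x‖ ^ 2 / r ^ 2) 0 ∂μ =
      μ.real (Metric.ball 0 1) * r ^ Module.finrank ℝ E *
        (2 / (Module.finrank ℝ E + 2)) := by
  rw [integral_fun_norm_addHaar μ (fun t => max (1 - t ^ 2 / r ^ 2) 0)]
  have hn : 0 < Module.finrank ℝ E := Module.finrank_pos
  obtain ⟨n, hn'⟩ : ∃ n, Module.finrank ℝ E = n + 1 := ⟨_, (Nat.succ_pred_eq_of_pos hn).symm⟩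
  rw [hn']
  have : ∫ y in Set.Ioi (0 : ℝ), y ^ (n + 1 - 1) • max (1 - y ^ 2 / r ^ 2) 0 =
      ∫ y in (0 : ℝ)..r, (y ^ n - y ^ (n + 2) / r ^ 2) := by
    rw [intervalIntegral.integral_of_le hr.le]
    refine (setIntegral_eq_of_subset_of_forall_sdiff_eq_zero (μ := volume) (s := Set.Ioc 0 r)
      (f := fun y : ℝ => y ^ (n + 1 - 1) • max (1 - y ^ 2 / r ^ 2) 0) (t := Set.Ioi 0) measurableSet_Ioi
      (fun y hy => hy.1) ?_).trans ?_
    rotate_left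
    · refine setIntegral_congr_fun measurableSet_Ioc fun y hy => ?_
      have : y ^ 2 / r ^ 2 ≤ 1 := by
        rw [div_le_one (by positivity)]
        exact pow_le_pow_left₀ hy.1.le hy.2 2
      simp only [Nat.add_sub_cancel, smul_eq_mul]
      rw [max_eq_left (by linarith)]
      ring
    · intro y hy
      have hy2 : r ≤ y := by
        by_contra hlt
        exact hy.2 ⟨hy.1, (not_le.1 hlt).le⟩
      have : 1 ≤ y ^ 2 / r ^ 2 := by
        rw [le_div_iff₀ (by positivity), one_mul]
        exact pow_le_pow_left₀ hr.le hy2 2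
      rw [max_eq_right (by linarith), smul_zero]
  rw [this, intervalIntegral.integral_sub (by simp) (by
    apply Continuous.intervalIntegrable; fun_prop), intervalIntegral.integral_div,
    integral_pow, integral_pow]
  simp only [nsmul_eq_mul, smul_eq_mul]
  push_cast
  rw [zero_pow (by omega), zero_pow (by omega)]
  field_simp
  ring

theorem volume_fundamentalDomain_euclidean {ι : Type*} [Fintype ι] [DecidableEq ι]
    (b : Module.Basis ι ℝ (EuclideanSpace ℝ ι)) :
    volume (ZSpan.fundamentalDomain b) =
      ENNReal.ofReal |(Matrix.of fun i j => b j i).det| := by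
  rw [ZSpan.measure_fundamentalDomain b volume (b₀ := (EuclideanSpace.basisFun ι ℝ).toBasis)]
  rw [measure_congr (ZSpan.fundamentalDomain_ae_parallelepiped _ volume),
    OrthonormalBasis.coe_toBasis, OrthonormalBasis.volume_parallelepiped, mul_one]
  congr 2

/-- Blichfeldt's bound: if `l` is at most the length of every nonzero vector of the lattice
`B ℤⁿ`, then the integral of the quadratic density supported on the ball of radius `l / √2` is at
most the covolume. -/
theorem blichfeldt_bound {ι : Type*} [Fintype ι] [DecidableEq ι] [Nonempty ι]
    {B : Matrix ι ι ℝ} (hB : B.det ≠ 0) {l : ℝ} (hl : 0 < l)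
    (h : ∀ x : ι → ℤ, x ≠ 0 → l ≤ ‖WithLp.toLp 2 (B.mulVec fun j => (x j : ℝ))‖) :
    √Real.pi ^ Fintype.card ι / Real.Gamma (Fintype.card ι / 2 + 1) *
      (l / √2) ^ Fintype.card ι * (2 / (Fintype.card ι + 2)) ≤ |B.det| := by
  set r := l / √2 with hr
  have hr0 : 0 < r := by positivity
  have hr2 : r ^ 2 = l ^ 2 / 2 := by rw [hr, div_pow, Real.sq_sqrt (by norm_num)]
  let _ := B.invertibleOfIsUnitDet hB.isUnit
  let e : (ι → ℝ) ≃ₗ[ℝ] EuclideanSpace ℝ ι :=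
    (Matrix.toLinearEquiv' B inferInstance).trans (WithLp.linearEquiv 2 ℝ (ι → ℝ)).symm
  have he : ∀ x, e x = WithLp.toLp 2 (B.mulVec x) := fun x => rfl
  let b := (Pi.basisFun ℝ ι).map e
  have hb : ∀ j, b j = e (Pi.single j 1) := fun j => by simp [b]
  have hdet : (Matrix.of fun i j => b j i) = B := by
    ext i j
    simp [hb, he]
  have hspan : ∀ v ∈ Submodule.span ℤ (Set.range b), v ≠ 0 → l ≤ ‖v‖ := by
    intro v hv hv0
    obtain ⟨c, rfl⟩ := (Submodule.mem_span_range_iff_exists_fun ℤ).1 hv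
    have hc : ∑ i, c i • b i = e fun j => (c j : ℝ) := by
      have : (fun j => (c j : ℝ)) = ∑ i, c i • (Pi.single i 1 : ι → ℝ) := by
        ext j
        simp [Finset.sum_apply, Pi.single_apply]
      rw [this, map_sum]
      exact Finset.sum_congr rfl fun i _ => by rw [map_zsmul, hb]
    rw [hc, he]
    refine h c fun h0 => hv0 ?_
    simp [h0]
  have hI := integral_one_sub_norm_sq (volume : Measure (EuclideanSpace ℝ ι)) hr0
  rw [finrank_euclideanSpace, Measure.real, EuclideanSpace.volume_ball] at hI
  have hG := Real.Gamma_pos_of_pos (s := (Fintype.card ι : ℝ) / 2 + 1) (by positivity)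
  have hV : (ENNReal.ofReal 1 ^ Fintype.card ι * ENNReal.ofReal
      (√Real.pi ^ Fintype.card ι / Real.Gamma (Fintype.card ι / 2 + 1))).toReal =
      √Real.pi ^ Fintype.card ι / Real.Gamma (Fintype.card ι / 2 + 1) := by
    rw [ENNReal.ofReal_one, one_pow, one_mul, ENNReal.toReal_ofReal (by positivity)]
  rw [hV] at hI
  rw [← hI, integral_eq_lintegral_of_nonneg_ae
    (f := fun x : EuclideanSpace ℝ ι => max (1 - ‖x‖ ^ 2 / r ^ 2) 0) (Filter.Eventually.of_forall fun x => le_max_right _ _)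
    (by fun_prop)]
  refine ENNReal.toReal_le_of_le_ofReal (abs_nonneg _) ?_
  have hfd := ZSpan.isAddFundamentalDomain' b (volume : Measure (EuclideanSpace ℝ ι))
  have : Countable (Submodule.span ℤ (Set.range b)).toAddSubgroup :=
    inferInstanceAs (Countable (Submodule.span ℤ (Set.range b)))
  -- Folded into a fundamental domain, the lattice translates of the density sum to at most 1 at
  -- every point.
  rw [hfd.lintegral_eq_tsum'', ← lintegral_tsum fun g => by fun_prop]
  calc _ ≤ ∫⁻ x in ZSpan.fundamentalDomain b, 1 := by
        refine lintegral_mono fun x => ?_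
        have := tsum_ofReal_one_sub_norm_sq_le_one hl
          (fun g : (Submodule.span ℤ (Set.range b)).toAddSubgroup => (g : EuclideanSpace ℝ ι) + x) (by
            intro g g' hgg
            rw [add_sub_add_right_eq_sub]
            exact hspan _ (sub_mem g.2 g'.2) (sub_ne_zero.2 fun h => hgg (Subtype.ext h)))
        refine le_trans (le_of_eq (tsum_congr fun g => ?_)) this
        rw [ENNReal.ofReal_max, ENNReal.ofReal_zero, max_eq_left zero_le, hr2,
          div_div_eq_mul_div, mul_comm]
        rfl
    _ = _ := by
      rw [lintegral_one, Measure.restrict_apply_univ, volume_fundamentalDomain_euclidean, hdet]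

/-- Blichfeldt's bound on the lattice minimum, in the linear form `γₙ ≤ 2 (n + 17) / 17`. -/
theorem two_mul_log_min_le {ι : Type*} [Fintype ι] [DecidableEq ι] (hn : 6 ≤ Fintype.card ι)
    {B : Matrix ι ι ℝ} (hB : B.det ≠ 0) {l : ℝ} (hl : 0 < l)
    (h : ∀ x : ι → ℤ, x ≠ 0 → l ≤ ‖WithLp.toLp 2 (B.mulVec fun j => (x j : ℝ))‖) :
    2 * Real.log l ≤ Real.log (2 * ((Fintype.card ι : ℝ) + 17) / 17) +
      2 / (Fintype.card ι : ℝ) * Real.log |B.det| := by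
  have : Nonempty ι := Fintype.card_pos_iff.1 (by omega)
  have hb := blichfeldt_bound hB hl h
  have hΓ := log_Gamma_half_add_two_le_linear hn
  set n := Fintype.card ι
  have hn0 : (0 : ℝ) < n := by exact_mod_cast (by omega : 0 < n)
  have hG := Real.Gamma_pos_of_pos (s := (n : ℝ) / 2 + 1) (by positivity)
  have hlog := Real.log_le_log (by positivity) hb
  rw [Real.log_mul (by positivity) (by positivity), Real.log_mul (by positivity) (by positivity),
    Real.log_div (by positivity) (by positivity), Real.log_pow, Real.log_pow,
    Real.log_div hl.ne' (by positivity), Real.log_sqrt (by positivity),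
    Real.log_sqrt (by positivity), Real.log_div (by positivity) (by positivity)] at hlog
  -- The factor 2/(n+2) merges with Γ(n/2+1) into Γ(n/2+2).
  rw [show (n : ℝ) / 2 + 2 = (n / 2 + 1) + 1 by ring, Real.Gamma_add_one (by positivity),
    Real.log_mul (by positivity) hG.ne', show (n : ℝ) / 2 + 1 = (n + 2) / 2 by ring,
    Real.log_div (by positivity) (by positivity),
    show Real.pi * ((n : ℝ) + 17) / 17 = Real.pi * ((n + 17) / 17) by ring,
    Real.log_mul (by positivity) (by positivity)] at hΓ
  rw [show (n : ℝ) / 2 + 1 = (n + 2) / 2 by ring] at hlog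
  rw [show 2 * ((n : ℝ) + 17) / 17 = 2 * ((n + 17) / 17) by ring,
    Real.log_mul (by positivity) (by positivity)]
  refine le_of_mul_le_mul_left (a := (n : ℝ) / 2) ?_ (by positivity)
  have e : (n : ℝ) / 2 * (2 / n * Real.log |B.det|) = Real.log |B.det| := by field_simp
  rw [mul_add, e]
  linarith

end Blichfeldt

/-! ### From diagonal entries of a KZ factor to Schnorr's constant. -/

theorem sum_average_sub_le {k : ℕ} (hk : 0 < k) {S c : ℕ → ℝ} (m : ℕ)
    (h : ∀ j, k ≤ j → j < k + m → 2 * (S (j + 1) - S j) ≤ c j + 2 / (j + 1 : ℝ) * S (j + 1)) :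
    2 * (S (k + m) / (k + m : ℕ) - S k / k) ≤ ∑ j ∈ Finset.range m, c (k + j) / (k + j : ℕ) := by
  induction m with
  | zero => simp
  | succ m ih =>
    rw [Finset.sum_range_succ]
    have h1 := ih fun j h1 h2 => h j h1 (by omega)
    have h2 := h (k + m) (by omega) (by omega)
    have hp : (0 : ℝ) < ((k + m : ℕ) : ℝ) := by exact_mod_cast (by omega : 0 < k + m)
    have e : ((k + (m + 1) : ℕ) : ℝ) = ((k + m : ℕ) : ℝ) + 1 := by push_cast; ring
    rw [e, ← add_assoc k m 1]
    set p : ℝ := ((k + m : ℕ) : ℝ)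
    have h3 : 2 * (S (k + m + 1) / (p + 1)) ≤ 2 * (S (k + m) / p) + c (k + m) / p := by
      refine le_of_mul_le_mul_left (a := p) ?_ hp
      have e1 : p * (2 * (S (k + m) / p) + c (k + m) / p) = 2 * S (k + m) + c (k + m) := by
        field_simp
      have e2 : p * (2 * (S (k + m + 1) / (p + 1))) =
          2 * S (k + m + 1) - 2 / (p + 1) * S (k + m + 1) := by
        field_simp
        ring
      rw [e1, e2]
      linarith
    linarith

theorem IsQRFactorization.diag_ne_zero {m n : ℕ} {A Q : Matrix (Fin m) (Fin n) ℝ}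
    {R : Matrix (Fin n) (Fin n) ℝ} (h : IsQRFactorization A Q R) (i : Fin n) : R i i ≠ 0 := by
  have hdet := h.2.2.2
  rw [Matrix.det_of_isUpperTriangular fun i j hij => h.2.2.1 i j hij] at hdet
  exact Finset.prod_ne_zero_iff.1 hdet i (Finset.mem_univ i)

theorem det_trailingBlock {n : ℕ} {R : Matrix (Fin n) (Fin n) ℝ}
    (h : ∀ i j : Fin n, j < i → R i j = 0) (i : Fin n) :
    (trailingBlock R i).det = ∏ j with i ≤ j, R j j := by
  have hT : (trailingBlock R i).IsUpperTriangular := fun a b hab => h a b hab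
  rw [Matrix.det_of_isUpperTriangular hT]
  exact (Finset.prod_subtype (Finset.univ.filter (i ≤ ·)) (by simp) fun j => R j j).symm

/-- The Blichfeldt bound for the diagonal entries of a KZ reduced triangular factor. -/
theorem IsKZFactor.two_mul_log_diag_le {n : ℕ} {R : Matrix (Fin n) (Fin n) ℝ}
    (hR : IsKZFactor R) (hT : ∀ i j : Fin n, j < i → R i j = 0) (hd : ∀ i, R i i ≠ 0)
    (i : Fin n) (hi : i.val + 6 ≤ n) :
    2 * Real.log |R i i| ≤ Real.log (2 * (((n - i.val : ℕ) : ℝ) + 17) / 17) +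
      2 / ((n - i.val : ℕ) : ℝ) * ∑ j with i ≤ j, Real.log |R j j| := by
  have hcard : Fintype.card {j : Fin n // i ≤ j} = n - i.val := by
    rw [Fintype.card_subtype, ← Fin.card_Ici]
    congr 1
    ext
    simp
  have hdet : (trailingBlock R i).det ≠ 0 := by
    rw [det_trailingBlock hT]
    exact Finset.prod_ne_zero_iff.2 fun j _ => hd j
  have h := two_mul_log_min_le (by omega) hdet (abs_pos.2 (hd i))
    fun x hx => (hR.2 i).2 ⟨x, hx, rfl⟩
  rw [hcard, det_trailingBlock hT, Finset.abs_prod,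
    Real.log_prod fun j _ => abs_ne_zero.2 (hd j)] at h
  exact h

theorem schnorrValues_le {k : ℕ} (hk : 5 ≤ k) {t : ℝ} (ht : t ∈ schnorrValues k) :
    0 < t ∧ Real.log t ≤ ∑ j ∈ Finset.range k,
      2 * (Real.log (2 * (((k + j : ℕ) : ℝ) + 18) / 17) / ((k + j : ℕ) : ℝ)) := by
  obtain ⟨m, A, Q, R, -, hQR, hKZ, rfl⟩ := ht
  have hd := hQR.diag_ne_zero
  set d : ℕ → ℝ := fun i => if h : i < 2 * k then Real.log |R ⟨i, h⟩ ⟨i, h⟩| else 0 with hdd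
  have hd' : ∀ i : Fin (2 * k), Real.log |R i i| = d i := fun i => by simp [hdd]
  set S : ℕ → ℝ := fun n => ∑ i ∈ Finset.Ico (2 * k - n) (2 * k), d i with hS
  have hsum (a : ℕ) : ∑ j : Fin (2 * k) with a ≤ j.val, Real.log |R j j| =
      ∑ i ∈ Finset.Ico a (2 * k), d i := by
    simp_rw [hd', Finset.sum_filter]
    rw [Fin.sum_univ_eq_sum_range (fun i => if a ≤ i then d i else 0), ← Finset.sum_filter]
    congr 1
    ext i
    simp [and_comm]
  have hstep : ∀ j, k ≤ j → j < k + k → 2 * (S (j + 1) - S j) ≤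
      Real.log (2 * ((j : ℝ) + 18) / 17) + 2 / (j + 1 : ℝ) * S (j + 1) := by
    intro j h1 h2
    -- The block starting at this zero-based index has size j + 1 ≥ k + 1 ≥ 6.
    have h := hKZ.two_mul_log_diag_le hQR.2.2.1 hd ⟨2 * k - (j + 1), by omega⟩ (by simp; omega)
    have e1 : 2 * k - (2 * k - (j + 1)) = j + 1 := by omega
    simp only [Fin.le_def] at h
    rw [hsum, hd', e1] at h
    have e2 : S (j + 1) = d (2 * k - (j + 1)) + S j := by
      rw [hS]
      simp only
      rw [Finset.sum_eq_sum_Ico_succ_bot (by omega)]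
      congr 3
      omega
    push_cast at h
    rw [show (j : ℝ) + 1 + 17 = j + 18 by ring] at h
    have e3 : S (j + 1) = ∑ i ∈ Finset.Ico (2 * k - (j + 1)) (2 * k), d i := rfl
    rw [← e3] at h
    linarith
  have hmain := sum_average_sub_le (by omega) k hstep
  have hk0 : (0 : ℝ) < k := by exact_mod_cast (by omega : 0 < k)
  have hP1 : (∏ i : Fin (2 * k) with i.val < k, R i i) ≠ 0 :=
    Finset.prod_ne_zero_iff.2 fun i _ => hd i
  have hP2 : (∏ i : Fin (2 * k) with k ≤ i.val, R i i) ≠ 0 :=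
    Finset.prod_ne_zero_iff.2 fun i _ => hd i
  have hpos := abs_pos.2 (div_ne_zero hP1 hP2)
  refine ⟨Real.rpow_pos_of_pos hpos _, ?_⟩
  rw [Real.log_rpow hpos, abs_div, Real.log_div (abs_ne_zero.2 hP1) (abs_ne_zero.2 hP2),
    Finset.abs_prod, Finset.abs_prod, Real.log_prod fun j _ => abs_ne_zero.2 (hd j),
    Real.log_prod fun j _ => abs_ne_zero.2 (hd j)]
  have hhigh : ∑ j : Fin (2 * k) with k ≤ j.val, Real.log |R j j| = S k := by
    rw [hsum, hS]
    simp only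
    congr 2
    omega
  have hlow : ∑ j : Fin (2 * k) with j.val < k, Real.log |R j j| = S (k + k) - S k := by
    have h1 := Finset.sum_filter_add_sum_filter_not (Finset.univ : Finset (Fin (2 * k)))
      (fun j => j.val < k) fun j => Real.log |R j j|
    simp only [not_lt] at h1
    have h2 := hsum 0
    simp only [Nat.zero_le, Finset.filter_true] at h2
    have h3 : S (k + k) = ∑ i ∈ Finset.Ico 0 (2 * k), d i := by
      rw [hS]
      simp only
      congr 2
      omega
    linarith
  rw [hhigh, hlow, ← Finset.mul_sum]
  have e : ((k + k : ℕ) : ℝ) = 2 * k := by push_cast; ring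
  rw [e] at hmain
  have e2 : 2 / (k : ℝ) * (S (k + k) - S k - S k) =
      2 * (2 * (S (k + k) / (2 * k) - S k / k)) := by
    field_simp
    ring
  rw [e2]
  linarith

theorem theorem3 (k : ℕ) (hk : 5 ≤ k) :
    BddAbove (schnorrValues k) ∧
    schnorrConstant k ≤
      (2 : ℝ) ^ (3 * Real.log 2) / (17 : ℝ) ^ (2 * Real.log 2) *
        ((4 * (k : ℝ) - 1) / 17) ^ (1 / (2 * (k : ℝ) - 1)) *
        Real.exp (18 / (k : ℝ)) * ((k : ℝ) - 0.5) ^ (2 * Real.log 2) := by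
  have hk' : (5 : ℝ) ≤ k := by exact_mod_cast hk
  have h1 : 0 < (4 * (k : ℝ) - 1) / 17 := by linarith
  have h2 : 0 < (k : ℝ) - 0.5 := by linarith
  have hbound := sum_log_div_le_log_bound hk
  set C := (2 : ℝ) ^ (3 * Real.log 2) / (17 : ℝ) ^ (2 * Real.log 2) *
        ((4 * (k : ℝ) - 1) / 17) ^ (1 / (2 * (k : ℝ) - 1)) *
        Real.exp (18 / (k : ℝ)) * ((k : ℝ) - 0.5) ^ (2 * Real.log 2) with hC
  have hC0 : 0 < C := by positivity
  have hle : ∀ t ∈ schnorrValues k, t ≤ C := fun t ht =>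
    have h := schnorrValues_le hk ht
    (Real.log_le_log_iff h.1 hC0).1 (h.2.trans hbound)
  -- `Real.sSup_le` with C ≥ 0 avoids proving that the set is nonempty.
  exact ⟨⟨C, hle⟩, Real.sSup_le hle hC0.le⟩
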